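/- For integers $n,k$ with $1\le k<n/2$, let $\mathrm{GP}(n,k)$ be the generalized Petersen graph: it has the $2n$ vertices $u_i, v_i$ and the edges $\{u_i,u_{i+1}\}$, $\{u_i,v_i\}$, $\{v_i,v_{i+k}\}$, where the subscripts $i$ are taken modulo $n$. Let $\mathrm{DGP}(n,k)$ be its canonical double cover, that is, the graph with vertex set $V(\mathrm{GP}(n,k))\times\mathbb{Z}_2$ in which $(x,a)$ and $(y,b)$ are adjacent if and only if $x$ and $y$ are adjacent in $\mathrm{GP}(n,k)$ and $a\neq b$. Let $A(n,k)$ be the automorphism group of $\mathrm{DGP}(n,k)$, and let $B(n,k)\le A(n,k)$ be the setwise stabilizer of the set of spokes, i.e. of the set of all edges $\{(u_i,j),(v_i,1-j)\}$ with $i\in\mathbb{Z}_n$ and $j\in\{0,1\}$. Let $n$ and $k$ be even integers with $1\le k<n/2$. Then $A(n,k)=B(n,k)$ if and only if $(n,k)\neq(10,2)$. Moreover, $A(10,2)\cong(\mathrm{A}_5\times\mathbb{Z}_2^2)\rtimes\mathbb{Z}_2$, where the generator of the complement $\mathbb{Z}_2$ acts on the alternating group $\mathrm{A}_5$ as conjugation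 by a transposition of $\mathrm{S}_5$ and on $\mathbb{Z}_2^2$ by interchanging the two coordinates. -/

import Mathlib

namespace GenPetersen

/-- The vertices `u_i` (`Sum.inl i`) and `v_i` (`Sum.inr i`), `i` modulo `n`. -/
abbrev Vert (n : ℕ) : Type := ZMod n ⊕ ZMod n

/-- The generating relation of the generalized Petersen graph: it holds exactly for the pairs
`(u_i, u_{i+1})`, `(u_i, v_i)` and `(v_i, v_{i+k})`. -/
def baseRel (n k : ℕ) : Vert n → Vert n → Prop
  | Sum.inl i, Sum.inl j => j = i + 1
  | Sum.inl i, Sum.inr j => j = i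
  | Sum.inr i, Sum.inr j => j = i + (k : ZMod n)
  | Sum.inr _, Sum.inl _ => False

/-- The generalized Petersen graph `GP(n,k)`. -/
def GP (n k : ℕ) : SimpleGraph (Vert n) :=
  SimpleGraph.fromRel (baseRel n k)

/-- The canonical double cover of `GP(n,k)`: the vertex `(w, 0)` is `Sum.inl w` and the vertex
`(w, 1)` is `Sum.inr w`. -/
abbrev DGP (n k : ℕ) : SimpleGraph (Vert n ⊕ Vert n) :=
  (GP n k).bipartiteDoubleCover

/-- `A(n,k)`: the full automorphism group of the canonical double cover of `GP(n,k)`. -/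
abbrev A (n k : ℕ) : Type := DGP n k ≃g DGP n k

/-- The set of spokes of the double cover: the edges `{(u_i, 0), (v_i, 1)}` and
`{(u_i, 1), (v_i, 0)}`. -/
def spokes (n : ℕ) : Set (Sym2 (Vert n ⊕ Vert n)) :=
  {e | ∃ i : ZMod n,
    e = s(Sum.inl (Sum.inl i), Sum.inr (Sum.inr i)) ∨
    e = s(Sum.inr (Sum.inl i), Sum.inl (Sum.inr i))}

/-- `B(n,k)`: the setwise stabilizer of the set of spokes in `A(n,k)`. -/
def B (n k : ℕ) : Subgroup (A n k) where
  carrier := {γ | Sym2.map γ '' spokes n = spokes n}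
  one_mem' := by
    change Sym2.map id '' spokes n = spokes n
    simp
  mul_mem' := by
    intro a b ha hb
    change Sym2.map (a ∘ b) '' spokes n = spokes n
    rw [Sym2.map_comp, Set.image_comp]
    change Sym2.map b '' spokes n = spokes n at hb
    rw [hb]
    exact ha
  inv_mem' := by
    intro a ha
    change Sym2.map a '' spokes n = spokes n at ha
    change Sym2.map a.symm '' spokes n = spokes n
    conv_lhs => rw [← ha]
    rw [← Set.image_comp, ← Sym2.map_comp]
    have h : (a.symm : _ → _) ∘ a = id := by
      funext x
      simp
    rw [h]
    simp

/-- The group `A₅ × ℤ₂²`, written multiplicatively. -/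
abbrev A5xV4 : Type :=
  alternatingGroup (Fin 5) × (Multiplicative (ZMod 2) × Multiplicative (ZMod 2))

/-- The involutory automorphism of `A₅ × ℤ₂²` that is conjugation by a transposition of `S₅` on
the first factor and the interchange of the two coordinates on the second factor. -/
def twist : MulAut A5xV4 :=
  MulEquiv.prodCongr (MulAut.conjNormal (Equiv.swap (0 : Fin 5) 1)) MulEquiv.prodComm

end GenPetersen

/-! For `(n, k) ≠ (10, 2)` spokes are recognised by an automorphism invariant of arcs, `octCount`:
the number of cyclically non-backtracking closed walks of length 8 through the arc. These walks lift
to a lattice graph that does not depend on `n` and `k`. They are the 8-step walks ending at a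
translate of the initial arc by some `(p, q)` with `n ∣ p + q k` and `p + q` even. The finitely many
displacements are computed once (`octDisps_*`), and counting the closed ones gives numbers `r`, `s`,
`t` for rim edges, spokes and inner edges. For even `n` and `k`, `r = s = t` forces `(10, 2)`
(`eq_ten_two_of_counts`); otherwise a spoke cannot be sent to a non-spoke (`spoke_preserved`).

For `(10, 2)` the graph is the double cover of the dodecahedron. An automorphism is determined by
the image of one path with three edges, which bounds the order by 480 (`card_A_ten_two_le`).
Modelling the dodecahedron's vertices as ordered pairs from a five-element set gives a faithful
action of the semidirect product, which has order 480, so `toAut` is an isomorphism. A 3-cycle in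
`A₅` moves a spoke to a rim edge. -/

namespace GenPetersen

/-! ### Non-backtracking walks and their lifts to covers. -/

section Walks

variable {V : Type*} [Fintype V]

open Classical in
/-- The sum of `f` over the final arcs of the non-backtracking walks that start with the arc
`(x, y)` and make `m` further steps. -/
noncomputable def walkSum (H : SimpleGraph V) : ℕ → V → V → (V → V → ℕ) → ℕ
  | 0, x, y, f => f x y
  | m + 1, x, y, f => ∑ z with H.Adj y z ∧ z ≠ x, walkSum H m y z f

theorem walkSum_iso (H : SimpleGraph V) (γ : H ≃g H) (m : ℕ) (x y : V) (f : V → V → ℕ) :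
    walkSum H m (γ x) (γ y) f = walkSum H m x y (fun a b => f (γ a) (γ b)) := by
  classical
  induction m generalizing x y with
  | zero => rfl
  | succ m ih =>
    simp only [walkSum]
    symm
    refine Finset.sum_bij (fun z _ => γ z) ?_ ?_ ?_ ?_
    · intro z hz
      simpa [γ.map_adj_iff] using hz
    · intro a _ b _ h
      exact γ.injective h
    · intro z hz
      refine ⟨γ.symm z, ?_, by simp⟩
      simp only [Finset.mem_filter, Finset.mem_univ, true_and] at hz ⊢
      refine ⟨?_, fun h => hz.2 (by rw [← h]; simp)⟩
      rw [← γ.map_adj_iff]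
      simpa using hz.1
    · intro z _
      exact (ih y z).symm

/-- The number of cyclically non-backtracking closed walks of length 8 starting with the arc
`(x, y)`. -/
noncomputable def octCount [DecidableEq V] (H : SimpleGraph V) (x y : V) : ℕ :=
  walkSum H 8 x y (fun a b => if a = x ∧ b = y then 1 else 0)

theorem octCount_iso [DecidableEq V] (H : SimpleGraph V) (γ : H ≃g H) (x y : V) :
    octCount H (γ x) (γ y) = octCount H x y := by
  simp only [octCount, walkSum_iso]
  refine congrArg (walkSum H 8 x y) (funext fun a => funext fun b => ?_)
  exact if_congr (and_congr γ.injective.eq_iff γ.injective.eq_iff) rfl rfl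

variable {W : Type*} [DecidableEq W]

/-- The final arcs of the non-backtracking walks that start with the arc `(x, y)` and make `m`
further steps, in a graph given by lists of neighbours. -/
def walkEnds (nb : W → List W) : ℕ → W → W → List (W × W)
  | 0, x, y => [(x, y)]
  | m + 1, x, y => ((nb y).filter (fun z => decide (z ≠ x))).flatMap (walkEnds nb m y)

theorem mem_walkEnds (nb : W → List W) (m : ℕ) (x y : W) (h : y ∈ nb x) (e : W × W)
    (he : e ∈ walkEnds nb m x y) : e.2 ∈ nb e.1 := by
  induction m generalizing x y with
  | zero =>
    simp only [walkEnds, List.mem_singleton] at he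
    subst he
    exact h
  | succ m ih =>
    simp only [walkEnds, List.mem_flatMap, List.mem_filter] at he
    obtain ⟨z, hz, he⟩ := he
    exact ih y z hz.1 he

/-- Walks lift uniquely because `π` is bijective on neighbourhoods. Non-backtracking is preserved
since `x` is itself a neighbour of `y`, where `π` is injective. The cover may be infinite, yet the
right-hand side is computable. -/
theorem walkSum_lift (H : SimpleGraph V) (nb : W → List W) (π : W → V)
    (hsymm : ∀ x y, y ∈ nb x → x ∈ nb y)
    (hnd : ∀ a, ((nb a).map π).Nodup)
    (hadj : ∀ a z, H.Adj (π a) z ↔ z ∈ (nb a).map π)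
    (m : ℕ) (x y : W) (h : y ∈ nb x) (f : V → V → ℕ) :
    walkSum H m (π x) (π y) f =
      ((walkEnds nb m x y).map (fun e => f (π e.1) (π e.2))).sum := by
  classical
  induction m generalizing x y with
  | zero => simp [walkSum, walkEnds]
  | succ m ih =>
    have hx := hsymm x y h
    have key : (Finset.univ.filter fun z => H.Adj (π y) z ∧ z ≠ π x) =
        (((nb y).filter (fun z => decide (z ≠ x))).map π).toFinset := by
      ext z
      simp only [Finset.mem_filter, Finset.mem_univ, true_and, hadj, List.mem_toFinset,
        List.mem_map, List.mem_filter, decide_eq_true_eq]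
      constructor
      · rintro ⟨⟨w, hw, rfl⟩, hne⟩
        exact ⟨w, ⟨hw, fun h => hne (by rw [h])⟩, rfl⟩
      · rintro ⟨w, ⟨hw, hne⟩, rfl⟩
        exact ⟨⟨w, hw, rfl⟩, fun h => hne (List.inj_on_of_nodup_map (hnd y) hw hx h)⟩
    rw [walkSum, key, List.sum_toFinset _ ((hnd y).sublist (List.filter_sublist.map π)),
      walkEnds, List.map_flatMap, List.map_map, List.flatMap_def, List.sum_flatten, List.map_map]
    congr 1
    exact List.map_congr_left fun z hz => ih y z (List.mem_of_mem_filter hz)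

end Walks

/-! ### Coordinates on the double cover and its lattice cover. -/

/-- The vertex of the double cover with given rim (`false`: `u`, `true`: `v`), index and sheet. -/
def vtx {n : ℕ} (c : Bool) (i : ZMod n) (s : ZMod 2) : Vert n ⊕ Vert n :=
  if s = 0 then Sum.inl (if c then Sum.inr i else Sum.inl i)
  else Sum.inr (if c then Sum.inr i else Sum.inl i)

@[simp] theorem vtx_zero {n : ℕ} (c : Bool) (i : ZMod n) :
    vtx c i 0 = Sum.inl (if c then Sum.inr i else Sum.inl i) := if_pos rfl

@[simp] theorem vtx_one {n : ℕ} (c : Bool) (i : ZMod n) :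
    vtx c i 1 = Sum.inr (if c then Sum.inr i else Sum.inl i) := if_neg (by decide)

theorem zmod_two_cases (s : ZMod 2) : s = 0 ∨ s = 1 := by
  revert s
  decide

theorem vtx_inj {n : ℕ} {c c' : Bool} {i i' : ZMod n} {s s' : ZMod 2} :
    vtx c i s = vtx c' i' s' ↔ c = c' ∧ i = i' ∧ s = s' := by
  rcases zmod_two_cases s with rfl | rfl <;> rcases zmod_two_cases s' with rfl | rfl <;>
    cases c <;> cases c' <;> simp

theorem exists_vtx {n : ℕ} (x : Vert n ⊕ Vert n) : ∃ c i s, x = vtx c i s := by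
  rcases x with (i | i) | (i | i)
  · exact ⟨false, i, 0, rfl⟩
  · exact ⟨true, i, 0, rfl⟩
  · exact ⟨false, i, 1, rfl⟩
  · exact ⟨true, i, 1, rfl⟩

/-- The step along the rim (`false`) or along an inner cycle (`true`). -/
def stepLen (n k : ℕ) (c : Bool) : ZMod n := if c then (k : ZMod n) else 1

theorem adj_vtx {n k : ℕ} (h1 : (1 : ZMod n) ≠ 0) (hk : (k : ZMod n) ≠ 0)
    (c c' : Bool) (i i' : ZMod n) (s s' : ZMod 2) :
    (DGP n k).Adj (vtx c i s) (vtx c' i' s') ↔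
      s' = s + 1 ∧ ((c' = c ∧ (i' = i + stepLen n k c ∨ i' = i - stepLen n k c)) ∨
        (c' = !c ∧ i' = i)) := by
  have e : ∀ a : ZMod n, i = i' + a ↔ i' = i - a := fun a => by
    rw [eq_sub_iff_add_eq, eq_comm]
  have hh : ∀ a : ZMod n, a ≠ 0 → (i' = i + a ∨ i' = i - a) → i ≠ i' := by
    rintro a ha h rfl
    rcases h with h | h <;> apply ha <;> simpa [eq_sub_iff_add_eq] using h
  have h1' := hh 1 h1
  have hk' := hh k hk
  have h2 : (1 : ZMod 2) + 1 = 0 := by decide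
  rcases zmod_two_cases s with rfl | rfl <;> rcases zmod_two_cases s' with rfl | rfl <;>
    cases c <;> cases c' <;>
    simp [GP, SimpleGraph.fromRel_adj, baseRel, stepLen, e, h2] <;>
    first | exact h1' | exact hk' | tauto


/-- The neighbours in the lattice cover of the double cover: the point `(c, p, q)` lies over a
vertex reached by `p` rim steps and `q` inner steps. -/
def latticeNbrs : Bool × ℤ × ℤ → List (Bool × ℤ × ℤ)
  | (false, p, q) => [(false, p + 1, q), (false, p - 1, q), (true, p, q)]
  | (true, p, q) => [(true, p, q + 1), (true, p, q - 1), (false, p, q)]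

/-- The covering map of the double cover by the lattice graph. -/
def latticeProj (n k : ℕ) (i : ZMod n) (s : ZMod 2) (a : Bool × ℤ × ℤ) : Vert n ⊕ Vert n :=
  vtx a.1 (i + (a.2.1 + a.2.2 * k)) (s + (a.2.1 + a.2.2 + if a.1 then 1 else 0))

theorem latticeNbrs_symm (x y : Bool × ℤ × ℤ) (h : y ∈ latticeNbrs x) : x ∈ latticeNbrs y := by
  obtain ⟨c, p, q⟩ := x
  cases c <;> simp only [latticeNbrs, List.mem_cons, List.not_mem_nil, or_false] at h <;>
    rcases h with rfl | rfl | rfl <;> simp [latticeNbrs]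

section

variable {n k : ℕ} (h1 : (1 : ZMod n) ≠ 0) (hk : (k : ZMod n) ≠ 0) (h2 : (1 : ZMod n) + 1 ≠ 0)
  (hk2 : (k : ZMod n) + k ≠ 0)
include h2 hk2

theorem latticeProj_nodup (i : ZMod n) (s : ZMod 2) (a : Bool × ℤ × ℤ) :
    ((latticeNbrs a).map (latticeProj n k i s)).Nodup := by
  obtain ⟨c, p, q⟩ := a
  have e : ∀ x y : ZMod n, x + y = x - y ↔ y + y = 0 := fun x y => by
    constructor <;> intro h
    · linear_combination h
    · linear_combination h
  have e1 : (p + 1 + q * k : ZMod n) = p - 1 + q * k ↔ (1 : ZMod n) + 1 = 0 := by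
    rw [← e (p + q * k)]
    ring_nf
  have e2 : (p + (q + 1) * k : ZMod n) = p + (q - 1) * k ↔ (k : ZMod n) + k = 0 := by
    rw [← e (p + q * k)]
    ring_nf
  cases c <;> simp [latticeNbrs, latticeProj, vtx_inj, e1, e2, h2, hk2]

omit h2 hk2 in
include h1 hk in
theorem latticeProj_adj (i : ZMod n) (s : ZMod 2) (a : Bool × ℤ × ℤ) (z : Vert n ⊕ Vert n) :
    (DGP n k).Adj (latticeProj n k i s a) z ↔ z ∈ (latticeNbrs a).map (latticeProj n k i s) := by
  obtain ⟨c, p, q⟩ := a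
  obtain ⟨c', i', s', rfl⟩ := exists_vtx z
  have t : (1 : ZMod 2) + 1 = 0 := by decide
  have tt : (-1 : ZMod 2) = 1 := by decide
  rw [latticeProj, adj_vtx h1 hk]
  cases c <;> cases c' <;>
    simp [latticeNbrs, latticeProj, vtx_inj, stepLen, add_assoc, t, sub_eq_add_neg, tt] <;>
    (try simp only [add_mul, one_mul, neg_mul, add_comm]) <;> tauto

omit h2 hk2 in
theorem latticeProj_eq_iff (i : ZMod n) (s : ZMod 2) (a x : Bool × ℤ × ℤ) :
    latticeProj n k i s a = latticeProj n k i s x ↔ a.1 = x.1 ∧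
      ((a.2.1 - x.2.1 : ℤ) : ZMod n) + ((a.2.2 - x.2.2 : ℤ) : ZMod n) * k = 0 ∧
      ((a.2.1 - x.2.1 : ℤ) : ZMod 2) + ((a.2.2 - x.2.2 : ℤ) : ZMod 2) = 0 := by
  rw [latticeProj, latticeProj, vtx_inj, ← sub_eq_zero (a := i + _), ← sub_eq_zero (a := s + _)]
  refine and_congr_right fun h => ?_
  rw [h]
  push_cast
  ring_nf

/-- Separates the condition on the shape of the arcs, free of `n` and `k`, from closedness of the
displacement. Arcs on the same rim with opposite directions cannot coincide, as that would give `2 =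
0` or `2k = 0` modulo `n`. -/
theorem arc_eq_iff (i : ZMod n) (s : ZMod 2) (a b x y : Bool × ℤ × ℤ) (hb : b ∈ latticeNbrs a)
    (hy : y ∈ latticeNbrs x) :
    (latticeProj n k i s a = latticeProj n k i s x ∧
      latticeProj n k i s b = latticeProj n k i s y) ↔
    (a.1 = x.1 ∧ b.1 = y.1 ∧ b.2 - a.2 = y.2 - x.2) ∧
      (((a.2.1 - x.2.1 : ℤ) : ZMod n) + ((a.2.2 - x.2.2 : ℤ) : ZMod n) * k = 0 ∧
       ((a.2.1 - x.2.1 : ℤ) : ZMod 2) + ((a.2.2 - x.2.2 : ℤ) : ZMod 2) = 0) := by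
  rw [latticeProj_eq_iff, latticeProj_eq_iff]
  constructor
  · rintro ⟨⟨h, h3, h4⟩, h5, h6, -⟩
    refine ⟨⟨h, h5, ?_⟩, h3, h4⟩
    obtain ⟨c, p, q⟩ := a
    obtain ⟨c', p', q'⟩ := x
    obtain rfl : c = c' := h
    cases c <;> simp only [latticeNbrs, List.mem_cons, List.not_mem_nil, or_false] at hb hy <;>
      rcases hb with rfl | rfl | rfl <;> rcases hy with rfl | rfl | rfl <;> simp at h3 h5 h6 ⊢
    · exact h2 (by linear_combination h6 - h3)
    · exact h2 (by linear_combination h3 - h6)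
    · exact hk2 (by linear_combination h6 - h3)
    · exact hk2 (by linear_combination h3 - h6)
  · rintro ⟨⟨h, h5, h6⟩, h3, h4⟩
    have h7 : b.2 - y.2 = a.2 - x.2 := by
      linear_combination h6
    have h8 := congrArg Prod.fst h7
    have h9 := congrArg Prod.snd h7
    simp only [Prod.fst_sub, Prod.snd_sub] at h8 h9
    refine ⟨⟨h, h3, h4⟩, h5, ?_⟩
    rw [h8, h9]
    exact ⟨h3, h4⟩

end

/-! ### Counting octagons by their displacements. -/

/-- The indicator of the displacements that are closed in the double cover. -/
def closedInd (n k : ℕ) (d : ℤ × ℤ) : ℕ :=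
  if (d.1 : ZMod n) + (d.2 : ZMod n) * k = 0 ∧ (d.1 : ZMod 2) + (d.2 : ZMod 2) = 0 then 1 else 0

/-- The displacements between the arc `(x, y)` and those final arcs of non-backtracking walks that
are translates of it. -/
def octDisps (x y : Bool × ℤ × ℤ) : List (ℤ × ℤ) :=
  ((walkEnds latticeNbrs 8 x y).filter
    (fun e => decide (e.1.1 = x.1 ∧ e.2.1 = y.1 ∧ e.2.2 - e.1.2 = y.2 - x.2))).map
      (fun e => e.1.2 - x.2)

theorem sum_map_ite_and {α : Type*} (l : List α) (p q : α → Prop) [DecidablePred p]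
    [DecidablePred q] :
    (l.map fun a => if p a ∧ q a then 1 else 0).sum =
      ((l.filter fun a => decide (p a)).map fun a => if q a then 1 else 0).sum := by
  induction l with
  | nil => rfl
  | cons a l ih =>
    by_cases h : p a <;> simp [h, ih]

theorem octCount_latticeProj {n k : ℕ} [NeZero n] (h1 : (1 : ZMod n) ≠ 0)
    (hk : (k : ZMod n) ≠ 0) (h2 : (1 : ZMod n) + 1 ≠ 0) (hk2 : (k : ZMod n) + k ≠ 0)
    (i : ZMod n) (s : ZMod 2) (x y : Bool × ℤ × ℤ) (hy : y ∈ latticeNbrs x) :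
    octCount (DGP n k) (latticeProj n k i s x) (latticeProj n k i s y) =
      ((octDisps x y).map (closedInd n k)).sum := by
  rw [octCount, walkSum_lift (DGP n k) latticeNbrs (latticeProj n k i s) latticeNbrs_symm
    (latticeProj_nodup h2 hk2 i s) (latticeProj_adj h1 hk i s) 8 x y hy,
    octDisps, List.map_map]
  refine Eq.trans ?_ (sum_map_ite_and _ _ _)
  refine congrArg List.sum (List.map_congr_left fun e he => ?_)
  exact if_congr (arc_eq_iff h2 hk2 i s e.1 e.2 x y (mem_walkEnds _ _ _ _ hy e he) hy) rfl rfl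

/-- Repeated entries are distinct walks with the same displacement. The entries `(0, 0)` are the
octagons that already close up in the lattice. -/
theorem octDisps_rim_pos : octDisps (false, 0, 0) (false, 1, 0) =
    [
      (8, 0), (5, 1), (5, -1), (4, 2), (5, 1), (4, -2), (5, -1), (3, 3), (4, 2), (5, 1),
      (3, -3), (4, -2), (5, -1), (2, 4), (3, 3), (4, 2), (5, 1), (2, -4), (3, -3), (4,
      -2), (5, -1), (1, 5), (2, 4), (3, 3), (4, 2), (5, 1), (2, 2), (2, 0), (0, 2), (0,
      0), (1, -5), (2, -4), (3, -3), (4, -2), (5, -1), (2, 0), (2, -2), (0, 0), (0, -2)] := by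
  decide +kernel

theorem octDisps_rim_neg : octDisps (false, 0, 0) (false, -1, 0) =
    [
      (-8, 0), (-5, 1), (-5, -1), (-4, 2), (-5, 1), (-4, -2), (-5, -1), (-3, 3), (-4, 2),
      (-5, 1), (-3, -3), (-4, -2), (-5, -1), (-2, 4), (-3, 3), (-4, 2), (-5, 1), (-2, -4),
      (-3, -3), (-4, -2), (-5, -1), (-1, 5), (-2, 4), (-3, 3), (-4, 2), (0, 2), (0, 0),
      (-5, 1), (-2, 2), (-2, 0), (-1, -5), (-2, -4), (-3, -3), (-4, -2), (0, 0), (0, -2),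
      (-5, -1), (-2, 0), (-2, -2)] := by
  decide +kernel

theorem octDisps_spoke_out : octDisps (false, 0, 0) (true, 0, 0) =
    [
      (1, 5), (-1, 5), (2, 4), (-2, 4), (3, 3), (-3, 3), (4, 2), (-4, 2), (5, 1), (2, 2),
      (0, 2), (2, 0), (0, 0), (-5, 1), (0, 2), (-2, 2), (0, 0), (-2, 0), (1, -5), (-1,
      -5), (2, -4), (-2, -4), (3, -3), (-3, -3), (4, -2), (-4, -2), (5, -1), (2, 0), (0,
      0), (2, -2), (0, -2), (-5, -1), (0, 0), (-2, 0), (0, -2), (-2, -2)] := by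
  decide +kernel

theorem octDisps_spoke_in : octDisps (true, 0, 0) (false, 0, 0) =
    [
      (5, 1), (5, -1), (4, 2), (4, -2), (3, 3), (3, -3), (2, 4), (2, -4), (1, 5), (2, 2),
      (2, 0), (0, 2), (0, 0), (1, -5), (2, 0), (2, -2), (0, 0), (0, -2), (-5, 1), (-5,
      -1), (-4, 2), (-4, -2), (-3, 3), (-3, -3), (-2, 4), (-2, -4), (-1, 5), (0, 2), (0,
      0), (-2, 2), (-2, 0), (-1, -5), (0, 0), (0, -2), (-2, 0), (-2, -2)] := by
  decide +kernel

theorem octDisps_inner_pos : octDisps (true, 0, 0) (true, 0, 1) =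
    [
      (0, 8), (1, 5), (-1, 5), (2, 4), (1, 5), (-2, 4), (-1, 5), (3, 3), (2, 4), (1, 5),
      (-3, 3), (-2, 4), (-1, 5), (4, 2), (3, 3), (2, 4), (1, 5), (-4, 2), (-3, 3), (-2,
      4), (-1, 5), (5, 1), (4, 2), (3, 3), (2, 4), (1, 5), (2, 2), (0, 2), (2, 0), (0, 0),
      (-5, 1), (-4, 2), (-3, 3), (-2, 4), (-1, 5), (0, 2), (-2, 2), (0, 0), (-2, 0)] := by
  decide +kernel

theorem octDisps_inner_neg : octDisps (true, 0, 0) (true, 0, -1) =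
    [
      (0, -8), (1, -5), (-1, -5), (2, -4), (1, -5), (-2, -4), (-1, -5), (3, -3), (2, -4),
      (1, -5), (-3, -3), (-2, -4), (-1, -5), (4, -2), (3, -3), (2, -4), (1, -5), (-4, -2),
      (-3, -3), (-2, -4), (-1, -5), (5, -1), (4, -2), (3, -3), (2, -4), (2, 0), (0, 0),
      (1, -5), (2, -2), (0, -2), (-5, -1), (-4, -2), (-3, -3), (-2, -4), (0, 0), (-2, 0),
      (-1, -5), (0, -2), (-2, -2)] := by
  decide +kernel


/-! ### Arithmetic of closed displacements. -/

theorem closedInd_eq (n k : ℕ) (p q : ℤ) :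
    closedInd n k (p, q) = if (n : ℤ) ∣ p + q * k ∧ (2 : ℤ) ∣ p + q then 1 else 0 := by
  refine if_congr (and_congr ?_ ?_) rfl rfl
  · rw [← ZMod.intCast_zmod_eq_zero_iff_dvd]
    push_cast
    rfl
  · have h := ZMod.intCast_zmod_eq_zero_iff_dvd (p + q) 2
    push_cast at h
    exact h

theorem closedInd_neg (n k : ℕ) (p q : ℤ) : closedInd n k (-p, -q) = closedInd n k (p, q) := by
  rw [closedInd_eq, closedInd_eq]
  refine if_congr (and_congr ?_ ?_) rfl rfl
  · rw [← dvd_neg]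
    ring_nf
  · rw [← dvd_neg]
    ring_nf

theorem closedInd_zero (n k : ℕ) : closedInd n k (0, 0) = 1 := by
  simp [closedInd]

/-- Modulo 2 the condition `n ∣ p + q k` makes `p` even, and then the sheet condition makes `q`
even. -/
theorem closedInd_odd {n k : ℕ} (hn : Even n) (hk : Even k) {p q : ℤ} (h : Odd p ∨ Odd q) :
    closedInd n k (p, q) = 0 := by
  rw [closedInd_eq, if_neg]
  rintro ⟨h1, h2⟩
  obtain ⟨m, rfl⟩ := hn
  obtain ⟨l, rfl⟩ := hk
  have h3 : (2 : ℤ) ∣ p := by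
    have h4 : (2 : ℤ) ∣ p + q * ((l + l : ℕ) : ℤ) := dvd_trans ⟨m, by push_cast; ring⟩ h1
    have h5 : (2 : ℤ) ∣ q * ((l + l : ℕ) : ℤ) := ⟨q * l, by push_cast; ring⟩
    exact (dvd_add_left h5).1 h4
  have h4 : (2 : ℤ) ∣ q := (dvd_add_right h3).1 h2
  rcases h with h | h <;> rw [← Int.not_even_iff_odd, even_iff_two_dvd] at h <;> contradiction

/-- A displacement with absolute value strictly between `0` and `n` is not closed. -/
theorem closedInd_small {n k : ℕ} {p q : ℤ} (h0 : 0 < p + q * k) (h1 : p + q * k < n) :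
    closedInd n k (p, q) = 0 := by
  rw [closedInd_eq, if_neg]
  rintro ⟨h, -⟩
  exact absurd (Int.le_of_dvd h0 h) (by omega)

/-- A displacement with value strictly between `0` and `2n` is closed only if it equals `n`. -/
theorem eq_of_closedInd_ne_zero {n k : ℕ} {p q : ℤ} (h : closedInd n k (p, q) ≠ 0)
    (h0 : 0 < p + q * k) (h1 : p + q * k < 2 * n) : p + q * k = n := by
  rw [closedInd_eq] at h
  have h2 : (n : ℤ) ∣ p + q * k := by
    by_contra h3
    exact h (if_neg fun h4 => h3 h4.1)
  obtain ⟨c, hc⟩ := h2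
  rw [hc] at h0 h1 ⊢
  have hn : (0 : ℤ) < n := by omega
  have : c = 1 := by
    have h3 : 0 < c := by
      by_contra h4
      nlinarith
    have h4 : c < 2 := by
      by_contra h4
      nlinarith
    omega
  rw [this, mul_one]

section

variable {n k : ℕ} (hn : Even n) (hk : Even k) (h1 : 1 ≤ k) (h2 : 2 * k < n)
include hn hk h1 h2

theorem closedInd_evals : closedInd n k (2, 0) = 0 ∧ closedInd n k (0, 2) = 0 ∧
    closedInd n k (2, -2) = 0 ∧ (∀ q, Odd q → ∀ p, closedInd n k (p, q) = 0) := by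
  obtain ⟨m, rfl⟩ := hn
  obtain ⟨l, rfl⟩ := hk
  refine ⟨?_, ?_, ?_, fun q hq p => closedInd_odd ⟨m, rfl⟩ ⟨l, rfl⟩ (Or.inr hq)⟩
  · exact closedInd_small (by omega) (by omega)
  · exact closedInd_small (by omega) (by omega)
  · rw [← closedInd_neg]
    exact closedInd_small (by omega) (by omega)

/-- Write `I` for `closedInd n k`, `a = I(4,2) + I(4,-2)` and `b = I(2,4) + I(2,-4)`. The hypotheses
reduce to `2a + I(8,0) = 2 + I(2,2) = 2b + I(0,8)`. Indicators are at most 1, so `a` and `b` are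
positive, and each gives a linear relation between `n` and `k`. Parity leaves only `(10, 2)` and
`(6, 2)`. -/
theorem eq_ten_two_of_counts
    (hrs : 2 + 4 * (closedInd n k (4, 2) + closedInd n k (4, -2)) +
        2 * (closedInd n k (2, 4) + closedInd n k (2, -4)) + closedInd n k (2, 2) +
        closedInd n k (8, 0) =
      4 + 2 * (closedInd n k (4, 2) + closedInd n k (4, -2)) +
        2 * (closedInd n k (2, 4) + closedInd n k (2, -4)) + 2 * closedInd n k (2, 2))
    (hst : 4 + 2 * (closedInd n k (4, 2) + closedInd n k (4, -2)) +
        2 * (closedInd n k (2, 4) + closedInd n k (2, -4)) + 2 * closedInd n k (2, 2) =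
      2 + 2 * (closedInd n k (4, 2) + closedInd n k (4, -2)) +
        4 * (closedInd n k (2, 4) + closedInd n k (2, -4)) + closedInd n k (2, 2) +
        closedInd n k (0, 8)) :
    (n, k) = (10, 2) := by
  have hle : ∀ d, closedInd n k d ≤ 1 := fun d => by
    unfold closedInd
    split_ifs <;> simp
  have l1 := hle (8, 0)
  have l2 := hle (0, 8)
  obtain ⟨m, hm⟩ := hn
  obtain ⟨l, hl⟩ := hk
  -- The case `k = 2` arises because `(4, -2)` then has value `4 - 2k = 0`; for larger `k` the value
  -- `2k - 4` lies strictly between `0` and `n`.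
  have ha : k = 2 ∨ n = 2 * k + 4 := by
    by_cases hz : closedInd n k (4, 2) = 0
    · have hz' : closedInd n k (4, -2) ≠ 0 := by omega
      by_contra hc
      refine hz' ?_
      rw [← closedInd_neg]
      exact closedInd_small (by omega) (by omega)
    · have := eq_of_closedInd_ne_zero hz (by omega) (by omega)
      omega
  have hb : n = 4 * k + 2 ∨ n = 4 * k - 2 := by
    by_cases hz : closedInd n k (2, 4) = 0
    · have hz' : closedInd n k (2, -4) ≠ 0 := by omega
      rw [← closedInd_neg] at hz'
      have := eq_of_closedInd_ne_zero hz' (by omega) (by omega)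
      omega
    · have := eq_of_closedInd_ne_zero hz (by omega) (by omega)
      omega
  by_cases h6 : n = 6
  · obtain rfl : k = 2 := by omega
    subst h6
    -- At `(6, 2)` the reduced first equation reads `2 = 3`.
    norm_num [closedInd_eq] at hrs
  · obtain rfl : k = 2 := by omega
    obtain rfl : n = 10 := by omega
    rfl

theorem sum_octDisps :
    ((octDisps (false, 0, 0) (false, 1, 0)).map (closedInd n k)).sum =
      2 + 4 * (closedInd n k (4, 2) + closedInd n k (4, -2)) +
      2 * (closedInd n k (2, 4) + closedInd n k (2, -4)) + closedInd n k (2, 2) +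
      closedInd n k (8, 0) ∧
    ((octDisps (false, 0, 0) (false, -1, 0)).map (closedInd n k)).sum =
      2 + 4 * (closedInd n k (4, 2) + closedInd n k (4, -2)) +
      2 * (closedInd n k (2, 4) + closedInd n k (2, -4)) + closedInd n k (2, 2) +
      closedInd n k (8, 0) ∧
    ((octDisps (false, 0, 0) (true, 0, 0)).map (closedInd n k)).sum =
      4 + 2 * (closedInd n k (4, 2) + closedInd n k (4, -2)) +
      2 * (closedInd n k (2, 4) + closedInd n k (2, -4)) + 2 * closedInd n k (2, 2) ∧
    ((octDisps (true, 0, 0) (false, 0, 0)).map (closedInd n k)).sum =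
      4 + 2 * (closedInd n k (4, 2) + closedInd n k (4, -2)) +
      2 * (closedInd n k (2, 4) + closedInd n k (2, -4)) + 2 * closedInd n k (2, 2) ∧
    ((octDisps (true, 0, 0) (true, 0, 1)).map (closedInd n k)).sum =
      2 + 2 * (closedInd n k (4, 2) + closedInd n k (4, -2)) +
      4 * (closedInd n k (2, 4) + closedInd n k (2, -4)) + closedInd n k (2, 2) +
      closedInd n k (0, 8) ∧
    ((octDisps (true, 0, 0) (true, 0, -1)).map (closedInd n k)).sum =
      2 + 2 * (closedInd n k (4, 2) + closedInd n k (4, -2)) +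
      4 * (closedInd n k (2, 4) + closedInd n k (2, -4)) + closedInd n k (2, 2) +
      closedInd n k (0, 8) := by
  obtain ⟨e1, e2, e3, e4⟩ := closedInd_evals hn hk h1 h2
  have o1 := e4 1 (by decide)
  have o2 := e4 (-1) (by decide)
  have o3 := e4 3 (by decide)
  have o4 := e4 (-3) (by decide)
  have o5 := e4 5 (by decide)
  have o6 := e4 (-5) (by decide)
  have z := closedInd_zero n k
  have e5 : closedInd n k (-2, 0) = 0 := by rw [← e1, ← closedInd_neg n k 2 0]; rfl
  have e6 : closedInd n k (0, -2) = 0 := by rw [← e2, ← closedInd_neg n k 0 2]; rfl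
  have e7 : closedInd n k (-2, 2) = 0 := by rw [← e3, ← closedInd_neg n k 2 (-2)]; rfl
  have e8 : closedInd n k (-2, -2) = closedInd n k (2, 2) := closedInd_neg n k 2 2
  have e9 : closedInd n k (-8, 0) = closedInd n k (8, 0) := closedInd_neg n k 8 0
  have e10 : closedInd n k (0, -8) = closedInd n k (0, 8) := closedInd_neg n k 0 8
  have e11 : closedInd n k (-4, -2) = closedInd n k (4, 2) := closedInd_neg n k 4 2
  have e12 : closedInd n k (-4, 2) = closedInd n k (4, -2) := by
    rw [← closedInd_neg n k 4 (-2)]; rfl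
  have e13 : closedInd n k (-2, -4) = closedInd n k (2, 4) := closedInd_neg n k 2 4
  have e14 : closedInd n k (-2, 4) = closedInd n k (2, -4) := by
    rw [← closedInd_neg n k 2 (-4)]; rfl
  rw [octDisps_rim_pos, octDisps_rim_neg, octDisps_spoke_out, octDisps_spoke_in,
    octDisps_inner_pos, octDisps_inner_neg]
  simp only [List.map_cons, List.map_nil, List.sum_cons, List.sum_nil, e1, e2, e3, e5, e6, e7, e8,
    e9, e10, e11, e12, e13, e14, o1, o2, o3, o4, o5, o6, z]
  refine ⟨?_, ?_, ?_, ?_, ?_, ?_⟩ <;> ring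

/-! ### Automorphisms preserve spokes outside `(10, 2)`. -/

/-- The number of octagons through an edge depends only on its kind, given by the rims of its
ends. -/
theorem exists_octCount [NeZero n] : ∃ r s t : ℕ,
    (∀ i i' a a', (DGP n k).Adj (vtx false i a) (vtx false i' a') →
      octCount (DGP n k) (vtx false i a) (vtx false i' a') = r) ∧
    (∀ c i i' a a', (DGP n k).Adj (vtx c i a) (vtx (!c) i' a') →
      octCount (DGP n k) (vtx c i a) (vtx (!c) i' a') = s) ∧
    (∀ i i' a a', (DGP n k).Adj (vtx true i a) (vtx true i' a') →
      octCount (DGP n k) (vtx true i a) (vtx true i' a') = t) ∧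
    (r = s → s = t → (n, k) = (10, 2)) := by
  have hcast : ∀ m : ℕ, 0 < m → m < n → (m : ZMod n) ≠ 0 := fun m h0 hm h => by
    rw [ZMod.natCast_eq_zero_iff] at h
    exact absurd (Nat.le_of_dvd h0 h) (by omega)
  have k1 : (1 : ZMod n) ≠ 0 := by simpa using hcast 1 (by omega) (by omega)
  have kk : (k : ZMod n) ≠ 0 := hcast k (by omega) (by omega)
  have k2 : (1 : ZMod n) + 1 ≠ 0 := by
    simpa only [Nat.cast_add, Nat.cast_one] using hcast (1 + 1) (by omega) (by omega)
  have kk2 : (k : ZMod n) + k ≠ 0 := by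
    simpa using hcast (k + k) (by omega) (by omega)
  obtain ⟨s1, s2, s3, s4, s5, s6⟩ := sum_octDisps hn hk h1 h2
  have key := fun (i : ZMod n) (s : ZMod 2) => octCount_latticeProj (k := k) k1 kk k2 kk2 i s
  -- The shift of the sheet compensates for the extra 1 that `latticeProj` adds over inner vertices.
  have base : ∀ (c : Bool) (i : ZMod n) (a : ZMod 2),
      vtx c i a = latticeProj n k i (a - if c then 1 else 0) (c, 0, 0) := by
    intro c i a
    simp [latticeProj]
  have step : ∀ (c : Bool) (i : ZMod n) (a : ZMod 2) (z : Vert n ⊕ Vert n),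
      (DGP n k).Adj (vtx c i a) z → ∃ w ∈ latticeNbrs (c, 0, 0),
        z = latticeProj n k i (a - if c then 1 else 0) w ∧
        octCount (DGP n k) (vtx c i a) z =
          ((octDisps (c, 0, 0) w).map (closedInd n k)).sum := by
    intro c i a z hz
    rw [base, latticeProj_adj k1 kk, List.mem_map] at hz
    obtain ⟨w, hw, rfl⟩ := hz
    exact ⟨w, hw, rfl, by rw [base, key i _ _ _ hw]⟩
  -- Unification reads the three counts off the hypotheses of `eq_ten_two_of_counts`.
  refine ⟨_, _, _, ?_, ?_, ?_, fun h h' => eq_ten_two_of_counts hn hk h1 h2 h h'⟩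
  · intro i i' a a' h
    obtain ⟨w, hw, e, h⟩ := step _ _ _ _ h
    rw [h]
    simp only [latticeNbrs, List.mem_cons, List.not_mem_nil, or_false] at hw
    rcases hw with rfl | rfl | rfl
    · exact s1
    · exact s2
    · exact absurd (vtx_inj.1 e).1 (by simp)
  · intro c i i' a a' h
    obtain ⟨w, hw, e, h⟩ := step _ _ _ _ h
    rw [h]
    cases c <;> simp only [latticeNbrs, List.mem_cons, List.not_mem_nil, or_false] at hw <;>
      rcases hw with rfl | rfl | rfl
    · exact absurd (vtx_inj.1 e).1 (by simp)
    · exact absurd (vtx_inj.1 e).1 (by simp)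
    · exact s3
    · exact absurd (vtx_inj.1 e).1 (by simp)
    · exact absurd (vtx_inj.1 e).1 (by simp)
    · exact s4
  · intro i i' a a' h
    obtain ⟨w, hw, e, h⟩ := step _ _ _ _ h
    rw [h]
    simp only [latticeNbrs, List.mem_cons, List.not_mem_nil, or_false] at hw
    rcases hw with rfl | rfl | rfl
    · exact s5
    · exact s6
    · exact absurd (vtx_inj.1 e).1 (by simp)

omit hn hk in
theorem adj_rim_stepped [NeZero n] (c : Bool) (i : ZMod n) (s : ZMod 2) :
    (DGP n k).Adj (vtx c i s) (vtx c (i + stepLen n k c) (s + 1)) := by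
  have hcast : ∀ m : ℕ, 0 < m → m < n → (m : ZMod n) ≠ 0 := fun m h0 hm h => by
    rw [ZMod.natCast_eq_zero_iff] at h
    exact absurd (Nat.le_of_dvd h0 h) (by omega)
  have k1 : (1 : ZMod n) ≠ 0 := by simpa using hcast 1 (by omega) (by omega)
  have kk : (k : ZMod n) ≠ 0 := hcast k (by omega) (by omega)
  rw [adj_vtx k1 kk]
  exact ⟨rfl, Or.inl ⟨rfl, Or.inl rfl⟩⟩

theorem spoke_preserved [NeZero n] (hne : (n, k) ≠ (10, 2)) (γ : DGP n k ≃g DGP n k)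
    {c : Bool} {i i' : ZMod n} {a a' : ZMod 2}
    (h : (DGP n k).Adj (vtx c i a) (vtx (!c) i' a')) :
    ∃ d j j' b b', γ (vtx c i a) = vtx d j b ∧ γ (vtx (!c) i' a') = vtx (!d) j' b' := by
  obtain ⟨r, s, t, hr, hs, ht, hrst⟩ := exists_octCount hn hk h1 h2
  have image : ∀ c i, ∀ a : ZMod 2, ∃ d j b, γ (vtx c i a) = vtx d j b := fun c i a =>
    exists_vtx _
  have count : ∀ (c c' : Bool) (i i' : ZMod n) (a a' : ZMod 2) (d d' : Bool) (j j' : ZMod n)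
      (b b' : ZMod 2), (DGP n k).Adj (vtx c i a) (vtx c' i' a') →
      γ (vtx c i a) = vtx d j b → γ (vtx c' i' a') = vtx d' j' b' →
      (bif xor c c' then s else bif c then t else r) =
        (bif xor d d' then s else bif d then t else r) := by
    intro c c' i i' a a' d d' j j' b b' hadj e e'
    have val : ∀ (c c' : Bool) (i i' : ZMod n) (a a' : ZMod 2),
        (DGP n k).Adj (vtx c i a) (vtx c' i' a') →
        octCount (DGP n k) (vtx c i a) (vtx c' i' a') =
          bif xor c c' then s else bif c then t else r := by
      intro c c' i i' a a' h
      cases c <;> cases c'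
      · exact hr _ _ _ _ h
      · exact hs _ _ _ _ _ h
      · exact hs _ _ _ _ _ h
      · exact ht _ _ _ _ h
    have hadj' := hadj
    rw [← γ.map_adj_iff, e, e'] at hadj'
    rw [← val _ _ _ _ _ _ hadj, ← val _ _ _ _ _ _ hadj', ← e, ← e', octCount_iso]
  obtain ⟨d, j, b, e⟩ := image c i a
  obtain ⟨d', j', b', e'⟩ := image (!c) i' a'
  obtain ⟨f, l, g, e1⟩ := image c (i + stepLen n k c) (a + 1)
  obtain ⟨f', l', g', e2⟩ := image (!c) (i' + stepLen n k (!c)) (a' + 1)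
  have q := count _ _ _ _ _ _ _ _ _ _ _ _ h e e'
  have q1 := count _ _ _ _ _ _ _ _ _ _ _ _ (adj_rim_stepped h1 h2 c i a) e e1
  have q2 := count _ _ _ _ _ _ _ _ _ _ _ _ (adj_rim_stepped h1 h2 (!c) i' a') e' e2
  have hne' : r ≠ s ∨ s ≠ t := by
    by_contra hc
    rw [not_or, not_not, not_not] at hc
    exact hne (hrst hc.1 hc.2)
  -- If the image of the spoke were, say, a rim edge, then `r = s`. The inner edge at the spoke's
  -- inner end goes to an edge at a rim vertex, so `t` is `r` or `s`, and all three counts agree.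
  -- The other case is symmetric.
  have hd : d' = !d := by
    cases c <;> cases d <;> cases d' <;> cases f <;> cases f' <;> simp at q q1 q2 ⊢ <;> omega
  exact ⟨d, j, j', b, b', e, by rw [e', hd]⟩

omit hn hk in
theorem mem_spokes_iff [NeZero n] (x y : Vert n ⊕ Vert n) : s(x, y) ∈ spokes n ↔
    (DGP n k).Adj x y ∧ ∃ c i i' a a', x = vtx c i a ∧ y = vtx (!c) i' a' := by
  have hcast : ∀ m : ℕ, 0 < m → m < n → (m : ZMod n) ≠ 0 := fun m h0 hm h => by
    rw [ZMod.natCast_eq_zero_iff] at h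
    exact absurd (Nat.le_of_dvd h0 h) (by omega)
  have k1 : (1 : ZMod n) ≠ 0 := by simpa using hcast 1 (by omega) (by omega)
  have kk : (k : ZMod n) ≠ 0 := hcast k (by omega) (by omega)
  constructor
  · rintro ⟨i, h | h⟩ <;> rw [Sym2.eq_iff] at h <;> rcases h with ⟨rfl, rfl⟩ | ⟨rfl, rfl⟩
    · refine ⟨?_, false, i, i, 0, 1, rfl, rfl⟩
      exact (adj_vtx k1 kk false true i i 0 1).2 (by simp)
    · refine ⟨?_, true, i, i, 1, 0, rfl, rfl⟩
      exact (adj_vtx k1 kk true false i i 1 0).2 (by simp; decide)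
    · refine ⟨?_, false, i, i, 1, 0, rfl, rfl⟩
      exact (adj_vtx k1 kk false true i i 1 0).2 (by simp; decide)
    · refine ⟨?_, true, i, i, 0, 1, rfl, rfl⟩
      exact (adj_vtx k1 kk true false i i 0 1).2 (by simp)
  · rintro ⟨h, c, i, i', a, a', rfl, rfl⟩
    rw [adj_vtx k1 kk] at h
    obtain ⟨rfl, ⟨h, -⟩ | ⟨-, rfl⟩⟩ := h
    · cases c <;> simp at h
    · have t : (1 : ZMod 2) + 1 = 0 := by decide
      refine ⟨i', ?_⟩
      rcases zmod_two_cases a with rfl | rfl <;> cases c <;> simp [t]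

theorem B_eq_top [NeZero n] (hne : (n, k) ≠ (10, 2)) : B n k = ⊤ := by
  have sub : ∀ γ : A n k, Sym2.map γ '' spokes n ⊆ spokes n := by
    rintro γ _ ⟨e, he, rfl⟩
    induction e with | h x y => ?_
    rw [mem_spokes_iff h1 h2] at he
    obtain ⟨hadj, c, i, i', a, a', rfl, rfl⟩ := he
    rw [Sym2.map_mk, mem_spokes_iff h1 h2]
    exact ⟨γ.map_adj_iff.2 hadj, spoke_preserved hn hk h1 h2 hne γ hadj⟩
  rw [eq_top_iff]
  intro γ _
  refine (sub γ).antisymm fun e he => ⟨Sym2.map γ.symm e, sub γ.symm ⟨e, he, rfl⟩, ?_⟩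
  rw [Sym2.map_map]
  have h : (γ : _ → _) ∘ γ.symm = id := by
    funext x
    simp
  rw [h, Sym2.map_id]
  rfl

end


/-! ### Upper bound for the order of `A 10 2`. -/

section Refinement

variable {V : Type*}

/-- Colour refinement with a fixed hash of the multiset of the neighbours' colours. -/
def refineColor (nb : V → List V) (c : V → ℕ) : ℕ → V → ℕ
  | 0, x => c x
  | t + 1, x => (5 * refineColor nb c t x +
      ((nb x).map fun z => refineColor nb c t z ^ 2 + 1).sum) % 1009

/-- The hash is a symmetric function of the neighbours' colours, so it is invariant whatever its
constants. Collisions could only weaken the refinement. -/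
theorem refineColor_iso {H : SimpleGraph V} {nb : V → List V} (hnd : ∀ x, (nb x).Nodup)
    (hadj : ∀ x z, H.Adj x z ↔ z ∈ nb x) (c : V → ℕ) (γ : H ≃g H) (hγ : ∀ x, c (γ x) = c x)
    (t : ℕ) (x : V) : refineColor nb c t (γ x) = refineColor nb c t x := by
  induction t generalizing x with
  | zero => exact hγ x
  | succ t ih =>
    have hp : ((nb x).map γ).Perm (nb (γ x)) := by
      rw [List.perm_ext_iff_of_nodup ((hnd x).map γ.injective) (hnd _)]
      intro z
      rw [List.mem_map, ← hadj]
      constructor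
      · rintro ⟨w, hw, rfl⟩
        exact γ.map_adj_iff.2 ((hadj x w).2 hw)
      · intro h
        refine ⟨γ.symm z, (hadj x _).1 ?_, by simp⟩
        rw [← γ.map_adj_iff]
        simpa using h
    have h2 : ((nb (γ x)).map fun z => refineColor nb c t z ^ 2 + 1).sum =
        ((nb x).map fun z => refineColor nb c t z ^ 2 + 1).sum := by
      rw [← (hp.map _).sum_eq, List.map_map]
      refine congrArg List.sum (List.map_congr_left fun z _ => ?_)
      simp only [Function.comp_apply, ih]
    rw [refineColor, refineColor, ih, h2]

end Refinement

/-- The neighbours of a vertex of `DGP(10,2)`. -/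
def nbrs102 : Vert 10 ⊕ Vert 10 → List (Vert 10 ⊕ Vert 10)
  | Sum.inl (Sum.inl i) => [Sum.inr (Sum.inl (i + 1)), Sum.inr (Sum.inl (i - 1)),
      Sum.inr (Sum.inr i)]
  | Sum.inl (Sum.inr i) => [Sum.inr (Sum.inr (i + 2)), Sum.inr (Sum.inr (i - 2)),
      Sum.inr (Sum.inl i)]
  | Sum.inr (Sum.inl i) => [Sum.inl (Sum.inl (i + 1)), Sum.inl (Sum.inl (i - 1)),
      Sum.inl (Sum.inr i)]
  | Sum.inr (Sum.inr i) => [Sum.inl (Sum.inr (i + 2)), Sum.inl (Sum.inr (i - 2)),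
      Sum.inl (Sum.inl i)]

theorem nbrs102_nodup : ∀ x, (nbrs102 x).Nodup := by
  decide +kernel

theorem adj_iff_mem_nbrs102 (x z : Vert 10 ⊕ Vert 10) : (DGP 10 2).Adj x z ↔ z ∈ nbrs102 x := by
  obtain ⟨c, i, s, rfl⟩ := exists_vtx x
  obtain ⟨c', i', s', rfl⟩ := exists_vtx z
  rw [adj_vtx (by decide) (by decide)]
  have t : (1 : ZMod 2) + 1 = 0 := by decide
  rcases zmod_two_cases s with rfl | rfl <;> rcases zmod_two_cases s' with rfl | rfl <;>
    cases c <;> cases c' <;> simp [nbrs102, stepLen, t]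

/-- The initial colouring individualizing four consecutive rim vertices. -/
def arcColor (x : Vert 10 ⊕ Vert 10) : ℕ :=
  if x = Sum.inl (Sum.inl 0) then 1
  else if x = Sum.inr (Sum.inl 1) then 2
  else if x = Sum.inl (Sum.inl 2) then 3
  else if x = Sum.inr (Sum.inl 3) then 4 else 0

/-- A numbering of the vertices of `DGP(10,2)`. -/
def vertexIndex : Vert 10 ⊕ Vert 10 → ℕ
  | Sum.inl (Sum.inl i) => i.val
  | Sum.inl (Sum.inr i) => 10 + i.val
  | Sum.inr (Sum.inl i) => 20 + i.val
  | Sum.inr (Sum.inr i) => 30 + i.val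

/-- The colours after six refinements. -/
def stableColors : List ℕ :=
  [672, 184, 582, 113, 437, 171, 434, 950, 256, 607, 969, 776, 309, 653, 842, 763, 632, 585,
    797, 529, 628, 941, 128, 933, 871, 923, 853, 322, 83, 179, 419, 860, 802, 328, 727, 185,
    971, 78, 243, 711]

theorem refineColor_eq : ∀ x, refineColor nbrs102 arcColor 6 x =
    stableColors.getD (vertexIndex x) 0 := by
  decide +kernel

theorem stableColors_inj : ∀ x y, stableColors.getD (vertexIndex x) 0 =
    stableColors.getD (vertexIndex y) 0 → x = y := by
  decide +kernel

/-- Fixing the four vertices preserves `arcColor`, hence the refined colours, and these separate all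
40 vertices. -/
theorem eq_one_of_fixes_arc (γ : A 10 2) (h0 : γ (Sum.inl (Sum.inl 0)) = Sum.inl (Sum.inl 0))
    (h1 : γ (Sum.inr (Sum.inl 1)) = Sum.inr (Sum.inl 1))
    (h2 : γ (Sum.inl (Sum.inl 2)) = Sum.inl (Sum.inl 2))
    (h3 : γ (Sum.inr (Sum.inl 3)) = Sum.inr (Sum.inl 3)) : γ = 1 := by
  have hc : ∀ x, arcColor (γ x) = arcColor x := by
    intro x
    have e : ∀ y, γ y = y → (γ x = y ↔ x = y) := fun y hy => by
      rw [← γ.injective.eq_iff (a := x), hy]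
    simp only [arcColor, e _ h0, e _ h1, e _ h2, e _ h3]
  ext1 x
  change γ x = x
  apply stableColors_inj
  rw [← refineColor_eq, ← refineColor_eq,
    refineColor_iso nbrs102_nodup adj_iff_mem_nbrs102 arcColor γ hc]

/-- The vertices of `DGP(10,2)`. -/
def vertices102 : List (Vert 10 ⊕ Vert 10) :=
  (List.finRange 10).flatMap fun i => [Sum.inl (Sum.inl i), Sum.inl (Sum.inr i),
    Sum.inr (Sum.inl i), Sum.inr (Sum.inr i)]

theorem mem_vertices102 : ∀ x, x ∈ vertices102 := by
  rintro ((i | i) | (i | i)) <;>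
    exact List.mem_flatMap.2 ⟨i, List.mem_finRange i, by simp⟩

/-- The paths with three edges in `DGP(10,2)`, with a direction. -/
def threeArcs : List (List (Vert 10 ⊕ Vert 10)) :=
  vertices102.flatMap fun a => (nbrs102 a).flatMap fun b =>
    ((nbrs102 b).filter fun c => decide (c ≠ a)).flatMap fun c =>
      ((nbrs102 c).filter fun d => decide (d ≠ b)).map fun d => [a, b, c, d]

theorem length_threeArcs : threeArcs.length = 480 := by
  decide +kernel

theorem mem_threeArcs {a b c d : Vert 10 ⊕ Vert 10} (hab : (DGP 10 2).Adj a b)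
    (hbc : (DGP 10 2).Adj b c) (hcd : (DGP 10 2).Adj c d) (hac : c ≠ a) (hbd : d ≠ b) :
    [a, b, c, d] ∈ threeArcs := by
  rw [adj_iff_mem_nbrs102] at hab hbc hcd
  simp only [threeArcs, List.mem_flatMap, List.mem_map, List.mem_filter, decide_eq_true_eq]
  exact ⟨a, mem_vertices102 a, b, hab, c, ⟨hbc, hac⟩, d, ⟨hcd, hbd⟩, rfl⟩

theorem card_A_ten_two_le : Finite (A 10 2) ∧ Nat.card (A 10 2) ≤ 480 := by
  -- Evaluation on the individualized path; there are `40 · 3 · 2 · 2 = 480` possible images.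
  let f : A 10 2 → {l // l ∈ threeArcs.toFinset} := fun γ =>
    ⟨[γ (Sum.inl (Sum.inl 0)), γ (Sum.inr (Sum.inl 1)), γ (Sum.inl (Sum.inl 2)),
      γ (Sum.inr (Sum.inl 3))], by
      rw [List.mem_toFinset]
      refine mem_threeArcs (γ.map_adj_iff.2 ?_) (γ.map_adj_iff.2 ?_) (γ.map_adj_iff.2 ?_)
        (γ.injective.ne ?_) (γ.injective.ne ?_) <;>
        first | decide | (rw [adj_iff_mem_nbrs102]; simp [nbrs102]; try decide)⟩
  have hf : Function.Injective f := by
    intro γ δ h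
    have h' := congrArg Subtype.val h
    simp only [f, List.cons.injEq, and_true] at h'
    obtain ⟨h0, h1, h2, h3⟩ := h'
    have e : δ⁻¹ * γ = 1 := by
      apply eq_one_of_fixes_arc <;> change δ.symm (γ _) = _ <;>
        simp only [h0, h1, h2, h3, RelIso.symm_apply_apply]
    exact (inv_mul_eq_one.1 e).symm
  refine ⟨Finite.of_injective f hf, ?_⟩
  refine (Nat.card_le_card_of_injective f hf).trans ?_
  rw [Nat.card_eq_fintype_card, Fintype.card_coe]
  exact (List.toFinset_card_le _).trans length_threeArcs.le


/-! ### The semidirect product acting on ordered pairs with a sheet. -/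

/-- The ordered pairs of distinct elements of a five-element set. -/
abbrev Pair5 : Type := {p : Fin 5 × Fin 5 // p.1 ≠ p.2}

/-- The natural action of permutations on ordered pairs. -/
def mapPair (π : Equiv.Perm (Fin 5)) (p : Pair5) : Pair5 :=
  ⟨(π p.1.1, π p.1.2), fun h => p.2 (π.injective h)⟩

/-- The reversal of ordered pairs, for `r = 1`. -/
def revPair (r : ZMod 2) (p : Pair5) : Pair5 :=
  if r = 0 then p else ⟨(p.1.2, p.1.1), fun h => p.2 h.symm⟩

theorem revPair_add (r r' : ZMod 2) (p : Pair5) :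
    revPair (r + r') p = revPair r (revPair r' p) := by
  have t : (1 : ZMod 2) + 1 = 0 := by decide
  rcases zmod_two_cases r with rfl | rfl <;> rcases zmod_two_cases r' with rfl | rfl <;>
    simp [revPair, t]

theorem mapPair_revPair (π : Equiv.Perm (Fin 5)) (r : ZMod 2) (p : Pair5) :
    mapPair π (revPair r p) = revPair r (mapPair π p) := by
  rcases zmod_two_cases r with rfl | rfl <;> simp [revPair, mapPair]

theorem mapPair_mul (π π' : Equiv.Perm (Fin 5)) (p : Pair5) :
    mapPair (π * π') p = mapPair π (mapPair π' p) := rfl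

/-- The map of `Pair5 × ZMod 2` given by a permutation, by a reversal that depends on the sheet,
and by a translation of the sheets. -/
def pairMove (π : Equiv.Perm (Fin 5)) (ε : ZMod 2 → ZMod 2) (d : ZMod 2) (x : Pair5 × ZMod 2) :
    Pair5 × ZMod 2 :=
  (revPair (ε x.2) (mapPair π x.1), x.2 + d)

theorem pairMove_pairMove (π π' : Equiv.Perm (Fin 5)) (ε ε' : ZMod 2 → ZMod 2) (d d' : ZMod 2)
    (x : Pair5 × ZMod 2) : pairMove π ε d (pairMove π' ε' d' x) =
      pairMove (π * π') (fun s => ε (s + d') + ε' s) (d' + d) x := by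
  simp only [pairMove, mapPair_revPair, mapPair_mul, revPair_add, add_assoc]

theorem pairMove_faithful {π : Equiv.Perm (Fin 5)} {ε : ZMod 2 → ZMod 2} {d : ZMod 2}
    (h : ∀ x, pairMove π ε d x = x) : π = 1 ∧ (∀ s, ε s = 0) ∧ d = 0 := by
  have hd : d = 0 := by
    have := congrArg Prod.snd (h (⟨(0, 1), by decide⟩, 0))
    simpa [pairMove] using this
  have hp : ∀ s p, revPair (ε s) (mapPair π p) = p := fun s p => congrArg Prod.fst (h (p, s))
  have he : ∀ s, ε s = 0 := by
    intro s
    -- A reversal would send both `(0, 1)` and `(0, 2)` to pairs with second entry `π 0`, which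
    -- cannot be both 1 and 2.
    by_contra hs
    have h1 : ε s = 1 := (zmod_two_cases _).resolve_left hs
    have h2 := hp s ⟨(0, 1), by decide⟩
    have h3 := hp s ⟨(0, 2), by decide⟩
    simp only [h1, revPair, mapPair, one_ne_zero, if_false, Subtype.mk.injEq,
      Prod.mk.injEq] at h2 h3
    exact absurd (h2.2.symm.trans h3.2) (by decide)
  refine ⟨?_, he, hd⟩
  ext1 i
  obtain ⟨j, hj⟩ : ∃ j, i ≠ j := (exists_ne i).imp fun _ h => h.symm
  have h1 := hp 0 ⟨(i, j), hj⟩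
  rw [he] at h1
  exact congrArg (fun p : Pair5 => p.1.1) h1

/-- The homomorphism of the cyclic group of order 2 to the automorphisms of `A₅ × ℤ₂²`. -/
def twistHom : Multiplicative (ZMod 2) →* MulAut A5xV4 where
  toFun z := if z = 1 then 1 else twist
  map_one' := rfl
  map_mul' := by
    have h : twist * twist = 1 := by
      ext1 ⟨π, x, y⟩
      refine Prod.ext ?_ rfl
      change MulAut.conjNormal _ (MulAut.conjNormal _ π) = π
      rw [← MulAut.mul_apply, ← map_mul, Equiv.swap_mul_self, map_one]
      rfl
    have t : ∀ z : Multiplicative (ZMod 2), z = 1 ∨ z = Multiplicative.ofAdd 1 := by decide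
    have e : Multiplicative.ofAdd (1 : ZMod 2) * Multiplicative.ofAdd 1 = 1 := by decide
    have e' : Multiplicative.ofAdd (1 : ZMod 2) ≠ 1 := by decide
    intro z z'
    rcases t z with rfl | rfl <;> rcases t z' with rfl | rfl <;> simp [e, e', h]

theorem twistHom_apply : twistHom (Multiplicative.ofAdd 1) = twist := rfl

/-- The transposition that acts on `A₅`, or the identity. -/
def swapPow (z : ZMod 2) : Equiv.Perm (Fin 5) := if z = 0 then 1 else Equiv.swap 0 1

/-- The action of `(A₅ × ℤ₂²) ⋊ ℤ₂` on the ordered pairs with a sheet. -/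
def pairAction (g : A5xV4 ⋊[twistHom] Multiplicative (ZMod 2)) : Pair5 × ZMod 2 → Pair5 × ZMod 2 :=
  pairMove (g.left.1.1 * swapPow g.right.toAdd)
    -- The generators `(1, 0)` and `(0, 1)` of `ℤ₂²` both exchange the sheets, the second also
    -- reversing pairs. The complement reverses only on sheet 1, so conjugation by it interchanges
    -- them.
    (fun s => g.left.2.2.toAdd + g.right.toAdd * s) (g.left.2.1.toAdd + g.left.2.2.toAdd)

theorem pairAction_mul (g h : A5xV4 ⋊[twistHom] Multiplicative (ZMod 2)) (x : Pair5 × ZMod 2) :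
    pairAction (g * h) x = pairAction g (pairAction h x) := by
  obtain ⟨⟨π, a, b⟩, z⟩ := g
  obtain ⟨⟨π', a', b'⟩, z'⟩ := h
  rw [pairAction, pairAction, pairAction, pairMove_pairMove]
  have t : ∀ z : Multiplicative (ZMod 2), z = 1 ∨ z = Multiplicative.ofAdd 1 := by decide
  have hs : Equiv.swap (0 : Fin 5) 1 * Equiv.swap 0 1 = 1 := Equiv.swap_mul_self _ _
  have key : ∀ {π₁ π₂ : Equiv.Perm (Fin 5)} {ε₁ ε₂ : ZMod 2 → ZMod 2} {d₁ d₂ : ZMod 2},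
      π₁ = π₂ → (∀ s, ε₁ s = ε₂ s) → d₁ = d₂ → pairMove π₁ ε₁ d₁ x = pairMove π₂ ε₂ d₂ x := by
    rintro π₁ π₂ ε₁ ε₂ d₁ d₂ rfl h rfl
    rw [funext h]
  rcases t z with rfl | rfl
  · have e : (⟨(π, a, b), 1⟩ * ⟨(π', a', b'), z'⟩ : A5xV4 ⋊[twistHom] Multiplicative (ZMod 2)) =
        ⟨(π * π', a * a', b * b'), 1 * z'⟩ := rfl
    rw [e]
    refine key ?_ (fun s => ?_) ?_
    · simp [swapPow, mul_assoc]
    · simp only [toAdd_mul, toAdd_one]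
      ring
    · simp only [toAdd_mul]
      ring
  · have e : (⟨(π, a, b), Multiplicative.ofAdd 1⟩ * ⟨(π', a', b'), z'⟩ :
          A5xV4 ⋊[twistHom] Multiplicative (ZMod 2)) =
        ⟨(π * MulAut.conjNormal (Equiv.swap 0 1) π', a * b', b * a'),
          Multiplicative.ofAdd 1 * z'⟩ := rfl
    rw [e]
    refine key ?_ (fun s => ?_) ?_
    · have h1 : swapPow (1 : ZMod 2) = Equiv.swap 0 1 := rfl
      have h2 : swapPow (1 + z'.toAdd) = Equiv.swap 0 1 * swapPow z'.toAdd := by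
        rcases t z' with rfl | rfl
        · rfl
        · exact hs.symm
      simp only [toAdd_mul, toAdd_ofAdd, h1, h2, Subgroup.coe_mul, MulAut.conjNormal_apply,
        Equiv.swap_inv, mul_assoc]
      rw [← mul_assoc (Equiv.swap 0 1) (Equiv.swap 0 1) (swapPow _), hs, one_mul]
    · have h2 : b'.toAdd + b'.toAdd = 0 := CharTwo.add_self_eq_zero _
      simp only [toAdd_mul, toAdd_ofAdd]
      linear_combination -h2
    · simp only [toAdd_mul]
      ring

theorem pairAction_one (x : Pair5 × ZMod 2) : pairAction 1 x = x := by
  simp [pairAction, pairMove, swapPow, mapPair, revPair]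

theorem pairAction_faithful {g : A5xV4 ⋊[twistHom] Multiplicative (ZMod 2)}
    (h : ∀ x, pairAction g x = x) : g = 1 := by
  obtain ⟨⟨π, a, b⟩, z⟩ := g
  obtain ⟨h1, h2, h3⟩ := pairMove_faithful h
  have hb : b = 1 := by simpa using h2 0
  subst hb
  have hz : z = 1 := by simpa using h2 1
  subst hz
  have ha : a = 1 := by simpa using h3
  subst ha
  have hp : π = 1 := by
    ext1
    simpa [swapPow] using h1
  subst hp
  rfl

/-- Adjacency of ordered pairs on opposite sheets. -/
def PairRel (p q : Pair5) : Prop :=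
  ∃ σ : Equiv.Perm (Fin 5), Equiv.Perm.sign σ = 1 ∧
    p.1 = (σ 0, σ 1) ∧ q.1 = (σ 2, σ 3)

/-- Reversing the first or second pair multiplies `σ` on the right by the transposition of `0, 1` or
of `2, 3`. An odd `π` is therefore compensated by one reversal more on one side. -/
theorem PairRel.move {p q : Pair5} (h : PairRel p q) (π : Equiv.Perm (Fin 5)) (a z : ZMod 2)
    (hπ : Equiv.Perm.sign π = if z = 0 then 1 else -1) :
    PairRel (revPair a (mapPair π p)) (revPair (a + z) (mapPair π q)) := by
  obtain ⟨σ, hσ, hp, hq⟩ := h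
  have t : (1 : ZMod 2) + 1 = 0 := by decide
  refine ⟨π * σ * ((if a = 0 then 1 else Equiv.swap 0 1) *
    if a + z = 0 then 1 else Equiv.swap 2 3), ?_, ?_, ?_⟩
  · rw [map_mul, map_mul, hσ, hπ]
    rcases zmod_two_cases a with rfl | rfl <;> rcases zmod_two_cases z with rfl | rfl <;>
      simp [t]
  all_goals
    rcases zmod_two_cases a with rfl | rfl <;> rcases zmod_two_cases z with rfl | rfl <;>
      simp [t, revPair, mapPair, hp, hq, Equiv.swap_apply_def]

theorem pairAction_rel {g : A5xV4 ⋊[twistHom] Multiplicative (ZMod 2)} {x y : Pair5 × ZMod 2}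
    (h : y.2 = x.2 + 1 ∧ PairRel x.1 y.1) :
    (pairAction g y).2 = (pairAction g x).2 + 1 ∧ PairRel (pairAction g x).1 (pairAction g y).1 := by
  obtain ⟨⟨π, a, b⟩, z⟩ := g
  obtain ⟨p, s⟩ := x
  obtain ⟨q, s'⟩ := y
  obtain ⟨rfl, h⟩ := h
  refine ⟨add_right_comm _ _ _, ?_⟩
  have e : b.toAdd + z.toAdd * (s + 1) = b.toAdd + z.toAdd * s + z.toAdd := by ring
  simp only [pairAction, pairMove, e]
  refine h.move _ _ _ ?_
  rw [map_mul, Equiv.Perm.mem_alternatingGroup.1 π.2, one_mul, swapPow]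
  split_ifs <;> simp

/-! ### Identification of `DGP 10 2` with the pair model, and the isomorphism. -/

/-- The ordered pair of a vertex of the dodecahedron. -/
def pairTable : List (Fin 5 × Fin 5) :=
  [(0, 1), (2, 3), (1, 4), (0, 2), (4, 3), (1, 0), (3, 2), (4, 1), (2, 0), (3, 4), (4, 2), (4,
    0), (3, 0), (3, 1), (2, 1), (2, 4), (0, 4), (0, 3), (1, 3), (1, 2)]

/-- The vertex of the dodecahedron of an ordered pair. -/
def vertexTable : List ℕ :=
  [0, 0, 3, 17, 16, 5, 0, 19, 18, 2, 8, 14, 0, 1, 15, 12, 13, 6, 0, 9, 11, 7, 10, 4, 0]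

/-- The entry of `pairTable` with the given index. -/
def tablePair (m : ℕ) : Pair5 :=
  if h : (pairTable.getD m (0, 1)).1 ≠ (pairTable.getD m (0, 1)).2 then ⟨pairTable.getD m (0, 1), h⟩
  else ⟨(0, 1), by decide⟩

/-- The identification of the vertices of `DGP(10,2)` with ordered pairs on two sheets. -/
def toPairs : Vert 10 ⊕ Vert 10 → Pair5 × ZMod 2
  | Sum.inl (Sum.inl i) => (tablePair i.val, 0)
  | Sum.inl (Sum.inr i) => (tablePair (10 + i.val), 0)
  | Sum.inr (Sum.inl i) => (tablePair i.val, 1)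
  | Sum.inr (Sum.inr i) => (tablePair (10 + i.val), 1)

/-- The inverse of `toPairs`. -/
def ofPairs (x : Pair5 × ZMod 2) : Vert 10 ⊕ Vert 10 :=
  -- The pair `(a, b)` has index `5a + b`, with filler on the diagonal. Values from 10 on denote
  -- inner vertices, and the cast to `ZMod 10` drops the 10.
  let m := vertexTable.getD (5 * x.1.1.1.val + x.1.1.2.val) 0
  vtx (decide (10 ≤ m)) m x.2

/-- The identification of the vertices of `DGP(10,2)` with ordered pairs on two sheets. -/
def pairEquiv : Vert 10 ⊕ Vert 10 ≃ Pair5 × ZMod 2 where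
  toFun := toPairs
  invFun := ofPairs
  left_inv := by
    unfold Function.LeftInverse
    decide +kernel
  right_inv := by
    unfold Function.RightInverse Function.LeftInverse
    decide +kernel

instance : DecidableRel PairRel := fun _ _ => inferInstanceAs (Decidable (∃ _, _))

theorem pairRel_of_adj : ∀ x, ∀ y ∈ nbrs102 x,
    (toPairs y).2 = (toPairs x).2 + 1 ∧ PairRel (toPairs x).1 (toPairs y).1 := by
  decide +kernel

theorem adj_of_pairRel : ∀ σ : Equiv.Perm (Fin 5), Equiv.Perm.sign σ = 1 →
    ∀ s, (nbrs102 (ofPairs (⟨(σ 0, σ 1), fun h => by simpa using σ.injective h⟩, s))).any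
      (fun z => decide (z =
        ofPairs (⟨(σ 2, σ 3), fun h => by simpa using σ.injective h⟩, s + 1))) = true := by
  decide +kernel


theorem adj_iff_pairRel (x y : Vert 10 ⊕ Vert 10) : (DGP 10 2).Adj x y ↔
    (pairEquiv y).2 = (pairEquiv x).2 + 1 ∧ PairRel (pairEquiv x).1 (pairEquiv y).1 := by
  rw [adj_iff_mem_nbrs102]
  refine ⟨pairRel_of_adj x y, ?_⟩
  rintro ⟨h, σ, hσ, hp, hq⟩
  have key := adj_of_pairRel σ hσ (pairEquiv x).2
  rw [List.any_eq_true] at key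
  obtain ⟨z, hz, e⟩ := key
  have ex : ∀ w, ofPairs (pairEquiv w) = w := pairEquiv.left_inv
  have e1 : (⟨(σ 0, σ 1), fun h => by simpa using σ.injective h⟩, (pairEquiv x).2) =
      pairEquiv x := Prod.ext (Subtype.ext hp.symm) rfl
  have e2 : (⟨(σ 2, σ 3), fun h => by simpa using σ.injective h⟩, (pairEquiv x).2 + 1) =
      pairEquiv y := Prod.ext (Subtype.ext hq.symm) h.symm
  rw [e1, ex] at hz
  rw [decide_eq_true_eq, e2, ex] at e
  exact e ▸ hz

/-- The permutation of the vertices of `DGP(10,2)` given by `pairAction`. -/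
def vertexAction (g : A5xV4 ⋊[twistHom] Multiplicative (ZMod 2)) (x : Vert 10 ⊕ Vert 10) :
    Vert 10 ⊕ Vert 10 :=
  pairEquiv.symm (pairAction g (pairEquiv x))

theorem vertexAction_mul (g h : A5xV4 ⋊[twistHom] Multiplicative (ZMod 2))
    (x : Vert 10 ⊕ Vert 10) : vertexAction (g * h) x = vertexAction g (vertexAction h x) := by
  simp only [vertexAction, pairAction_mul, Equiv.apply_symm_apply]

theorem vertexAction_one (x : Vert 10 ⊕ Vert 10) : vertexAction 1 x = x := by
  simp only [vertexAction, pairAction_one, Equiv.symm_apply_apply]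

theorem vertexAction_adj (g : A5xV4 ⋊[twistHom] Multiplicative (ZMod 2))
    {x y : Vert 10 ⊕ Vert 10} (h : (DGP 10 2).Adj x y) :
    (DGP 10 2).Adj (vertexAction g x) (vertexAction g y) := by
  rw [adj_iff_pairRel] at h ⊢
  simp only [vertexAction, Equiv.apply_symm_apply]
  exact pairAction_rel h

theorem vertexAction_inv_left (g : A5xV4 ⋊[twistHom] Multiplicative (ZMod 2))
    (x : Vert 10 ⊕ Vert 10) : vertexAction g⁻¹ (vertexAction g x) = x := by
  rw [← vertexAction_mul, inv_mul_cancel, vertexAction_one]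

/-- The homomorphism of `(A₅ × ℤ₂²) ⋊ ℤ₂` to the automorphism group of `DGP(10,2)`. -/
def toAut : A5xV4 ⋊[twistHom] Multiplicative (ZMod 2) →* A 10 2 where
  toFun g :=
    { toFun := vertexAction g
      invFun := vertexAction g⁻¹
      left_inv := vertexAction_inv_left g
      right_inv := fun x => by rw [← vertexAction_mul, mul_inv_cancel, vertexAction_one]
      map_rel_iff' := by
        intro x y
        refine ⟨fun h => ?_, fun h => vertexAction_adj g h⟩
        have h' := vertexAction_adj g⁻¹ h
        simp only [Equiv.coe_fn_mk, vertexAction_inv_left] at h'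
        exact h' }
  map_one' := RelIso.ext vertexAction_one
  map_mul' g h := RelIso.ext (vertexAction_mul g h)

theorem toAut_injective : Function.Injective toAut := by
  rw [injective_iff_map_eq_one]
  intro g hg
  apply pairAction_faithful
  intro x
  have h : vertexAction g (pairEquiv.symm x) = pairEquiv.symm x :=
    congrArg (fun γ : A 10 2 => γ (pairEquiv.symm x)) hg
  simpa [vertexAction] using h

theorem card_semidirect : Nat.card (A5xV4 ⋊[twistHom] Multiplicative (ZMod 2)) = 480 := by
  have h : Nat.card (alternatingGroup (Fin 5)) = 60 := by
    rw [nat_card_alternatingGroup]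
    simp [Nat.factorial]
  rw [SemidirectProduct.card, Nat.card_prod, Nat.card_prod, h]
  simp

theorem toAut_bijective : Function.Bijective toAut := by
  have := card_A_ten_two_le.1
  exact toAut_injective.bijective_of_nat_card_le
    (card_A_ten_two_le.2.trans card_semidirect.ge)

/-! ### A moved spoke for `(10, 2)`, and the conclusion. -/

/-- The 3-cycle that fixes `0` and `1`. -/
def rotation : alternatingGroup (Fin 5) :=
  ⟨Equiv.swap 2 4 * Equiv.swap 2 3, by
    rw [Equiv.Perm.mem_alternatingGroup]
    decide⟩

/-- The 3-cycle fixes `u_0`, labelled `(0, 1)`, and sends `v_0`, labelled `(4, 2)`, to `u_1`,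
labelled `(2, 3)`. -/
theorem B_ten_two_ne_top : B 10 2 ≠ ⊤ := by
  intro h
  have hm : toAut ⟨(rotation, 1), 1⟩ ∈ B 10 2 := by
    rw [h]
    trivial
  have h1 : s(Sum.inl (Sum.inl 0), Sum.inr (Sum.inr 0)) ∈ spokes 10 := ⟨0, Or.inl rfl⟩
  have h2 := (Set.ext_iff.1 (show Sym2.map _ '' spokes 10 = spokes 10 from hm) _).1 ⟨_, h1, rfl⟩
  have e0 : toAut ⟨(rotation, 1), 1⟩ (Sum.inl (Sum.inl 0)) = Sum.inl (Sum.inl 0) := by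
    decide +kernel
  have e1 : toAut ⟨(rotation, 1), 1⟩ (Sum.inr (Sum.inr 0)) = Sum.inr (Sum.inl 1) := by
    decide +kernel
  rw [Sym2.map_mk, e0, e1] at h2
  obtain ⟨i, h3 | h3⟩ := h2 <;> simp at h3

end GenPetersen

theorem proposition5p9 :
    (∀ n k : ℕ, Even n → Even k → 1 ≤ k → 2 * k < n →
      (GenPetersen.B n k = ⊤ ↔ (n, k) ≠ (10, 2))) ∧
    ∃ φ : Multiplicative (ZMod 2) →* MulAut GenPetersen.A5xV4,
      φ (Multiplicative.ofAdd 1) = GenPetersen.twist ∧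
      Nonempty (GenPetersen.A 10 2 ≃* GenPetersen.A5xV4 ⋊[φ] Multiplicative (ZMod 2)) := by
  refine ⟨fun n k hn hk h1 h2 => ⟨?_, fun hne => ?_⟩, GenPetersen.twistHom,
    GenPetersen.twistHom_apply,
    ⟨(MulEquiv.ofBijective GenPetersen.toAut GenPetersen.toAut_bijective).symm⟩⟩
  · rintro h e
    obtain ⟨rfl, rfl⟩ := Prod.mk.inj e
    exact GenPetersen.B_ten_two_ne_top h
  · have : NeZero n := ⟨by omega⟩
    exact GenPetersen.B_eq_top hn hk h1 h2 hne
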